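/- Let $N\ge 5$ be an integer, let $p$ satisfy $2+\frac8N<p<\min\{4,\frac{2N}{N-4}\}$, let $a,\mu>0$, and put $\gamma_p=\frac{N(p-2)}{4p}$. Let $H^2(\mathbb R^N)=\{u\in L^2(\mathbb R^N;\mathbb R):\nabla u,\Delta u\in L^2\}$, and let $C_{N,p}>0$ be any constant for which the Gagliardo–Nirenberg inequality $$\|u\|_p\le C_{N,p}\,\|u\|_2^{1-\gamma_p}\|\Delta u\|_2^{\gamma_p}\qquad(u\in H^2(\mathbb R^N))$$ holds. Assume that $$\mu^{p\gamma_p-2}a^{p-2}<\tilde C(N,p):=\frac{p}{2(p\gamma_p-1)C_{N,p}^p}\Big(\frac{p\gamma_p-2}{p\gamma_p-1}\Big)^{p\gamma_p-2}.$$ For $b>0$ let $S_b=\{u\in H^2(\mathbb R^N):\|u\|_2^2=b^2\}$, and define $$E_\mu(u)=\tfrac12\|\Delta u\|_2^2-\tfrac\mu2\|\nabla u\|_2^2-\tfrac1p\|u\|_p^p,\qquad \Phi_0(v)=\|\Delta v\|_2^2-2\|\nabla v\|_2^2-\tfrac1p\|v\|_p^p,$$ $$h(t)=\tfrac12t^2-\tfrac{\mu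 a}{2}t-\tfrac{C_{N,p}^p}{p}a^{p(1-\gamma_p)}t^{p\gamma_p},\qquad \tilde c=\Big(\frac8{\mu^2}\Big)^{\frac2{p-2}}\Big(\frac\mu2\Big)^{\frac N2},$$ $$\tilde h(\tau)=\tau^2-2a\sqrt{\tilde c}\,\tau-\tfrac{C_{N,p}^p}{p}(a\sqrt{\tilde c})^{p(1-\gamma_p)}\tau^{p\gamma_p}.$$ Let $R_0=\inf\{t>0:h(t)>0\}$ and $\tilde R_0=\inf\{\tau>0:\tilde h(\tau)>0\}$ be the left end points of the intervals on which $h$ and $\tilde h$ are positive, and set $$m(a,\mu)=\inf\{E_\mu(u):u\in S_a,\ \|\Delta u\|_2<R_0\},\qquad m_r(a,\mu)=\inf\{E_\mu(u):u\in S_a\text{ radial},\ \|\Delta u\|_2<R_0\},$$ $$m_{\Phi_0}(a,\mu)=\inf\{\Phi_0(v):v\in S_{a\sqrt{\tilde c}},\ \|\Delta v\|_2<\tilde R_0\}.$$ Then $$m_{\Phi_0}(a,\mu)<-\tilde c\,a^2,\qquad m(a,\mu)<-\frac{a^2\mu^2}{8},\qquad m_r(a,\mu)<-\frac{a^2\mu^2}{8}.$$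 -/

import Mathlib

open MeasureTheory
open scoped ENNReal ContDiff Laplacian

noncomputable section

namespace BiharmonicNLS

/-- The Euclidean space `ℝ^N`. -/
abbrev E (N : ℕ) : Type := EuclideanSpace ℝ (Fin N)

/-- `g` is the weak (distributional) gradient of `u`: for every test function `φ ∈ C_c^∞(ℝ^N)` and
every direction `y`, `∫ u ∂_y φ = - ∫ ⟨g, y⟩ φ`. -/
def HasWeakGradient {N : ℕ} (u : E N → ℝ) (g : E N → E N) : Prop :=
  ∀ φ : E N → ℝ, ContDiff ℝ ∞ φ → HasCompactSupport φ → ∀ y : E N,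
    ∫ x, u x * fderiv ℝ φ x y = -∫ x, inner ℝ (g x) y * φ x

/-- `w` is the weak (distributional) Laplacian of `u`: for every test function
`φ ∈ C_c^∞(ℝ^N)`, `∫ u Δφ = ∫ w φ`. -/
def HasWeakLaplacian {N : ℕ} (u : E N → ℝ) (w : E N → ℝ) : Prop :=
  ∀ φ : E N → ℝ, ContDiff ℝ ∞ φ → HasCompactSupport φ →
    ∫ x, u x * (Δ φ) x = ∫ x, w x * φ x

/-- An element of `H²(ℝ^N) = {u ∈ L² : ∇u, Δu ∈ L²}` (real-valued), recorded by a representative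
of `u` together with representatives of its weak gradient and of its weak Laplacian. The latter two
are determined by `u` up to null sets, and everything below depends on the three functions only up
to null sets. -/
structure H2 (N : ℕ) where
  /-- the function `u` -/
  toFun : E N → ℝ
  /-- its weak gradient `∇u` -/
  grad : E N → E N
  /-- its weak Laplacian `Δu` -/
  lap : E N → ℝ
  memLp_toFun : MemLp toFun 2 volume
  memLp_grad : MemLp grad 2 volume
  memLp_lap : MemLp lap 2 volume
  hasWeakGradient : HasWeakGradient toFun grad
  hasWeakLaplacian : HasWeakLaplacian toFun lap

/-- The exponent `γ_p = N (p - 2) / (4 p)`. -/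
def gam (N : ℕ) (p : ℝ) : ℝ := N * (p - 2) / (4 * p)

/-- The norm `‖u‖_q` of `L^q(ℝ^N)` as a real number, for real- or vector-valued functions. -/
def lnorm {N : ℕ} {F : Type*} [NormedAddCommGroup F] (f : E N → F) (q : ℝ) : ℝ :=
  (eLpNorm f (ENNReal.ofReal q) volume).toReal

/-- The best constant in the Gagliardo–Nirenberg inequality
`‖u‖_p ≤ C ‖u‖_2^(1-γ_p) ‖Δu‖_2^γ_p`, `u ∈ H²(ℝ^N)`: the supremum of the quotients
(in `[0, ∞]`, where `0 / 0 = 0`, so that `u = 0` contributes nothing). -/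
def bestGN (N : ℕ) (p : ℝ) : ℝ≥0∞ :=
  ⨆ u : H2 N, eLpNorm u.toFun (ENNReal.ofReal p) volume /
    (eLpNorm u.toFun 2 volume ^ (1 - gam N p) * eLpNorm u.lap 2 volume ^ gam N p)

/-- The threshold `C̃(N,p)` formed with the Gagliardo–Nirenberg constant `C`. -/
def Ctilde (N : ℕ) (p C : ℝ) : ℝ :=
  p / (2 * (p * gam N p - 1) * C ^ p) *
    ((p * gam N p - 2) / (p * gam N p - 1)) ^ (p * gam N p - 2)

/-- The energy `E_μ(u) = ½‖Δu‖₂² - (μ/2)‖∇u‖₂² - (1/p)‖u‖_p^p`. -/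
def energy {N : ℕ} (p μ : ℝ) (u : H2 N) : ℝ :=
  1 / 2 * lnorm u.lap 2 ^ 2 - μ / 2 * lnorm u.grad 2 ^ 2 - 1 / p * lnorm u.toFun p ^ p

/-- The rescaled energy `Φ₀(v) = ‖Δv‖₂² - 2‖∇v‖₂² - (1/p)‖v‖_p^p`. -/
def Phi0 {N : ℕ} (p : ℝ) (v : H2 N) : ℝ :=
  lnorm v.lap 2 ^ 2 - 2 * lnorm v.grad 2 ^ 2 - 1 / p * lnorm v.toFun p ^ p

/-- The mass constraint `S_a = {u ∈ H² : ‖u‖₂² = a²}`. -/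
def sphere (N : ℕ) (a : ℝ) : Set (H2 N) := {u | lnorm u.toFun 2 ^ 2 = a ^ 2}

/-- `u` is radial: `u(x) = f(|x|)` for almost every `x`. -/
def IsRadial {N : ℕ} (u : H2 N) : Prop := ∃ f : ℝ → ℝ, ∀ᵐ x, u.toFun x = f ‖x‖

/-- `A_k = {u ∈ S_a : ‖Δu‖₂ < k}`. -/
def ballA (N : ℕ) (a k : ℝ) : Set (H2 N) := {u ∈ sphere N a | lnorm u.lap 2 < k}

/-- `A_k^r`, the radial elements of `A_k`. -/
def ballArad (N : ℕ) (a k : ℝ) : Set (H2 N) := {u ∈ ballA N a k | IsRadial u}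

/-- `h(t) = ½ t² - (μ a / 2) t - (C^p / p) a^(p(1-γ_p)) t^(pγ_p)`. -/
def hfun (N : ℕ) (p C a μ t : ℝ) : ℝ :=
  1 / 2 * t ^ 2 - μ * a / 2 * t - C ^ p / p * a ^ (p * (1 - gam N p)) * t ^ (p * gam N p)

/-- The left end point `R₀` of the interval `{t > 0 : h(t) > 0} = (R₀, R₁)`. -/
def R0 (N : ℕ) (p C a μ : ℝ) : ℝ := sInf {t : ℝ | 0 < t ∧ 0 < hfun N p C a μ t}

/-- The local minimum level `m(a, μ) = inf_{A_{R₀}} E_μ`. -/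
def mLevel (N : ℕ) (p C a μ : ℝ) : ℝ := sInf (energy p μ '' ballA N a (R0 N p C a μ))

/-- The radial local minimum level `m_r(a, μ) = inf_{A_{R₀}^r} E_μ`. -/
def mLevelRad (N : ℕ) (p C a μ : ℝ) : ℝ := sInf (energy p μ '' ballArad N a (R0 N p C a μ))

/-- The scaling constant `c̃ = (8/μ²)^(2/(p-2)) (μ/2)^(N/2)`. -/
def ctil (N : ℕ) (p μ : ℝ) : ℝ :=
  (8 / μ ^ 2) ^ (2 / (p - 2)) * (μ / 2) ^ ((N : ℝ) / 2)

/-- `h̃(τ) = τ² - 2 a √c̃ τ - (C^p / p) (a √c̃)^(p(1-γ_p)) τ^(pγ_p)`. -/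
def htil (N : ℕ) (p C a μ τ : ℝ) : ℝ :=
  τ ^ 2 - 2 * (a * √(ctil N p μ)) * τ -
    C ^ p / p * (a * √(ctil N p μ)) ^ (p * (1 - gam N p)) * τ ^ (p * gam N p)

/-- The left end point `R̃₀` of the interval `{τ > 0 : h̃(τ) > 0} = (R̃₀, R̃₁)`. -/
def R0til (N : ℕ) (p C a μ : ℝ) : ℝ := sInf {τ : ℝ | 0 < τ ∧ 0 < htil N p C a μ τ}

/-- The rescaled level `m_{Φ₀}(a, μ) = inf {Φ₀(v) : v ∈ S_{a√c̃}, ‖Δv‖₂ < R̃₀}`. -/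
def mPhi0 (N : ℕ) (p C a μ : ℝ) : ℝ :=
  sInf (Phi0 p '' ballA N (a * √(ctil N p μ)) (R0til N p C a μ))

end BiharmonicNLS

end

/-!
With `G_{κ,θ}(u) = ‖Δu‖₂² - 2κ‖∇u‖₂² - θ‖u‖_p^p` (`genEnergy`) one has
`E_μ = ½ G_{μ/2, 2/p}` and `Φ₀ = G_{1, 1/p}`. Green's formula `‖∇u‖₂² = -∫ u Δu` completes the
square: `‖Δu‖₂² - 2κ‖∇u‖₂² = ‖Δu + κu‖₂² - κ²‖u‖₂²`. So all three inequalities say that, on the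
sphere of mass `b²`, some admissible radial `u` satisfies `‖Δu + κu‖₂² < θ‖u‖_p^p`.

Such a `u` is a multiple of the inverse Fourier transform of a smooth radial cutoff `η` to the
shell `|4π²|ξ|² - κ| < ε`. By Plancherel `‖Δu + κu‖₂² ≤ ε² b²`. The transform has no cancellation on
a fixed ball around the origin and the shell has volume at least `cε`, so that
`‖u‖_p^p ≥ c ε^(p/2)` (`exists_schwartz_concentrating`). Since `p < 4`, the second quantity
dominates as `ε → 0` (`exists_radial_genEnergy_lt`).

Moreover `‖Δu‖₂ < 2κb` for these `u`. The smallness hypothesis makes the sets defining `R₀` and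
`R̃₀` nonempty, and `h(t) > 0` forces `t > μa` while `h̃(τ) > 0` forces `τ > 2a√c̃`; hence
`2κb` is at most `R₀`, respectively `R̃₀` (`le_R0`, `le_R0til`), and `u` is a competitor for the
infimum. The infima are over sets that are bounded below (`bddBelow_genEnergy`), by the
Gagliardo–Nirenberg inequality and `‖∇u‖₂² ≤ ‖u‖₂‖Δu‖₂`.

Green's formula for a general element of `H²` (`H2.lnorm_grad_sq`) is proved on the Fourier side:
the weak identities are extended from `C_c^∞` to Schwartz test functions by cutoffs
(`HasWeakDiv.schwartz`), read as identities of tempered distributions, and turned into pointwise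
identities between `L²` Fourier transforms (`HasWeakDiv.fourier`).
-/

noncomputable section

namespace BiharmonicNLS

open Filter Topology
open scoped SchwartzMap LineDeriv FourierTransform

variable {N : ℕ} {ι : Type*} [Fintype ι]

/-! ### Weak derivatives tested against Schwartz functions -/

/-- The derivative falling on the cutoff carries a factor `1 / (n + 1)`, so it disappears in the
limit. -/
theorem tendsto_cutoff_integral {u : E N → ℝ} (hu : MemLp u 2 volume) (m : E N)
    (χ : ContDiffBump (0 : E N)) (φ : 𝓢(E N, ℝ)) :
    Tendsto (fun n : ℕ => ∫ x, u x *
        fderiv ℝ (fun x => χ (((n : ℝ) + 1)⁻¹ • x) * φ x) x m) atTop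
      (𝓝 (∫ x, u x * fderiv ℝ φ x m)) := by
  obtain ⟨K, hK⟩ : ∃ K, ∀ x, ‖fderiv ℝ χ x‖ ≤ K :=
    (χ.hasCompactSupport.fderiv ℝ).exists_bound_of_continuous
      ((χ.contDiff (n := 1)).continuous_fderiv (by simp))
  have hder : ∀ (n : ℕ) (x : E N),
      fderiv ℝ (fun x => χ (((n : ℝ) + 1)⁻¹ • x) * φ x) x m
        = χ (((n : ℝ) + 1)⁻¹ • x) * fderiv ℝ φ x m
          + φ x * (((n : ℝ) + 1)⁻¹ * fderiv ℝ χ (((n : ℝ) + 1)⁻¹ • x) m) := by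
    intro n x
    have h0 : HasFDerivAt (fun x : E N => ((n : ℝ) + 1)⁻¹ • x)
        (((n : ℝ) + 1)⁻¹ • ContinuousLinearMap.id ℝ (E N)) x :=
      (((n : ℝ) + 1)⁻¹ • ContinuousLinearMap.id ℝ (E N)).hasFDerivAt
    have h1 : HasFDerivAt (fun x : E N => χ (((n : ℝ) + 1)⁻¹ • x))
        ((fderiv ℝ χ (((n : ℝ) + 1)⁻¹ • x)).comp
          (((n : ℝ) + 1)⁻¹ • ContinuousLinearMap.id ℝ (E N))) x :=
      HasFDerivAt.comp (g := (χ : E N → ℝ)) x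
        ((χ.contDiff (n := 1)).differentiable (by simp) _).hasFDerivAt h0
    have h2 : HasFDerivAt (fun x => χ (((n : ℝ) + 1)⁻¹ • x) * φ x) _ x :=
      h1.mul (φ.hasFDerivAt x)
    rw [h2.fderiv]
    simp
  have hcont : Continuous χ := χ.continuous
  have hpd : MemLp (fun x => fderiv ℝ φ x m) 2 volume := (∂_{m} φ).memLp 2 volume
  have hdom : Integrable (fun x => |u x| * (|fderiv ℝ φ x m| + (K * ‖m‖) * |φ x|)) volume :=
    hu.abs.integrable_mul (hpd.abs.add ((φ.memLp 2 volume).abs.const_mul _))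
  refine tendsto_integral_of_dominated_convergence _ ?_ hdom ?_ ?_
  · intro n
    simp_rw [hder]
    have h2 : Continuous (fun x => fderiv ℝ φ x m) := (∂_{m} φ).continuous
    have h3 : Continuous (fun x : E N => fderiv ℝ χ (((n : ℝ) + 1)⁻¹ • x) m) :=
      (((χ.contDiff (n := 1)).continuous_fderiv (by simp)).comp (by fun_prop)).clm_apply
        continuous_const
    have h4 := φ.continuous
    exact hu.1.mul (by fun_prop : Continuous _).aestronglyMeasurable
  · intro n
    refine Eventually.of_forall fun x => ?_
    rw [hder, norm_mul, Real.norm_eq_abs]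
    refine mul_le_mul_of_nonneg_left ?_ (abs_nonneg _)
    refine (norm_add_le _ _).trans ?_
    rw [norm_mul, norm_mul, norm_mul]
    simp only [Real.norm_eq_abs]
    have hn : |((n : ℝ) + 1)⁻¹| ≤ 1 := by
      rw [abs_of_nonneg (by positivity)]
      exact inv_le_one_of_one_le₀ (by linarith [(Nat.cast_nonneg n : (0 : ℝ) ≤ n)])
    have hχ : |χ (((n : ℝ) + 1)⁻¹ • x)| ≤ 1 := by
      rw [abs_of_nonneg χ.nonneg]; exact χ.le_one
    have hχ' : |fderiv ℝ χ (((n : ℝ) + 1)⁻¹ • x) m| ≤ K * ‖m‖ := by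
      refine ((fderiv ℝ χ _).le_opNorm m).trans ?_
      gcongr
      exact hK _
    have h5 : |((n : ℝ) + 1)⁻¹| * |fderiv ℝ χ (((n : ℝ) + 1)⁻¹ • x) m| ≤ 1 * (K * ‖m‖) :=
      mul_le_mul hn hχ' (abs_nonneg _) zero_le_one
    have h6 := mul_le_mul_of_nonneg_right hχ (abs_nonneg (fderiv ℝ φ x m))
    have h7 := mul_le_mul_of_nonneg_left h5 (abs_nonneg (φ x))
    linarith
  · refine Eventually.of_forall fun x => ?_
    simp_rw [hder]
    have hn : Tendsto (fun n : ℕ => ((n : ℝ) + 1)⁻¹) atTop (𝓝 0) := by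
      simpa using tendsto_one_div_add_atTop_nhds_zero_nat (𝕜 := ℝ)
    have hnx : Tendsto (fun n : ℕ => ((n : ℝ) + 1)⁻¹ • x) atTop (𝓝 0) := by
      simpa using hn.smul_const x
    have h1 : Tendsto (fun n : ℕ => χ (((n : ℝ) + 1)⁻¹ • x)) atTop (𝓝 1) := by
      have := (hcont.tendsto 0).comp hnx
      rwa [χ.one_of_mem_closedBall (by simpa using χ.rIn_pos.le)] at this
    have h2 : Tendsto (fun n : ℕ => fderiv ℝ χ (((n : ℝ) + 1)⁻¹ • x) m) atTop
        (𝓝 (fderiv ℝ χ 0 m)) :=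
      ((((χ.contDiff (n := 1)).continuous_fderiv (by simp)).clm_apply
        continuous_const).tendsto 0).comp hnx
    have := (((h1.mul_const (fderiv ℝ φ x m)).add
      ((hn.mul h2).const_mul (φ x))).const_mul (u x))
    simpa using this

theorem tendsto_cutoff_integral_mul {v : E N → ℝ} (hv : MemLp v 2 volume)
    (χ : ContDiffBump (0 : E N)) (φ : 𝓢(E N, ℝ)) :
    Tendsto (fun n : ℕ => ∫ x, v x * (χ (((n : ℝ) + 1)⁻¹ • x) * φ x)) atTop
      (𝓝 (∫ x, v x * φ x)) := by
  have hcont : Continuous χ := χ.continuous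
  have hdom : Integrable (fun x => |v x| * |φ x|) volume :=
    hv.abs.integrable_mul (φ.memLp 2 volume).abs
  refine tendsto_integral_of_dominated_convergence _ ?_ hdom ?_ ?_
  · intro n
    have h4 := φ.continuous
    exact hv.1.mul (by fun_prop : Continuous _).aestronglyMeasurable
  · intro n
    refine Eventually.of_forall fun x => ?_
    rw [norm_mul, norm_mul]
    simp only [Real.norm_eq_abs]
    have hχ : |χ (((n : ℝ) + 1)⁻¹ • x)| ≤ 1 := by
      rw [abs_of_nonneg χ.nonneg]; exact χ.le_one
    have := mul_le_mul_of_nonneg_right hχ (abs_nonneg (φ x))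
    exact mul_le_mul_of_nonneg_left (by linarith) (abs_nonneg _)
  · refine Eventually.of_forall fun x => ?_
    have hn : Tendsto (fun n : ℕ => ((n : ℝ) + 1)⁻¹) atTop (𝓝 0) := by
      simpa using tendsto_one_div_add_atTop_nhds_zero_nat (𝕜 := ℝ)
    have hnx : Tendsto (fun n : ℕ => ((n : ℝ) + 1)⁻¹ • x) atTop (𝓝 0) := by
      simpa using hn.smul_const x
    have h1 : Tendsto (fun n : ℕ => χ (((n : ℝ) + 1)⁻¹ • x)) atTop (𝓝 1) := by
      have := (hcont.tendsto 0).comp hnx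
      rwa [χ.one_of_mem_closedBall (by simpa using χ.rIn_pos.le)] at this
    simpa using (h1.mul_const (φ x)).const_mul (v x)

/-- `v` is the weak divergence of the fields `u i` in the directions `m i`, tested against
`C_c^∞`: `∑ ∫ u_i ∂_{m_i} φ = - ∫ v φ`. With one field this is a weak directional derivative. -/
def HasWeakDiv (u : ι → E N → ℝ) (m : ι → E N) (v : E N → ℝ) : Prop :=
  ∀ φ : E N → ℝ, ContDiff ℝ ∞ φ → HasCompactSupport φ →
    ∑ i, ∫ x, u i x * fderiv ℝ φ x (m i) = -∫ x, v x * φ x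

/-- The weak divergence identity persists for Schwartz test functions when all fields are square
integrable: multiply the test function by `χ(x / (n + 1))` and let `n → ∞`. -/
theorem HasWeakDiv.schwartz {u : ι → E N → ℝ} {m : ι → E N} {v : E N → ℝ}
    (h : HasWeakDiv u m v) (hu : ∀ i, MemLp (u i) 2 volume) (hv : MemLp v 2 volume)
    (φ : 𝓢(E N, ℝ)) :
    ∑ i, ∫ x, u i x * fderiv ℝ φ x (m i) = -∫ x, v x * φ x := by
  let χ : ContDiffBump (0 : E N) := ⟨1, 2, one_pos, one_lt_two⟩
  have h1 := tendsto_finsetSum Finset.univ fun i _ =>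
    tendsto_cutoff_integral (hu i) (m i) χ φ
  have h2 := (tendsto_cutoff_integral_mul hv χ φ).neg
  refine tendsto_nhds_unique h1 (h2.congr fun n => (h _ ?_ ?_).symm)
  · exact (χ.contDiff.comp (contDiff_const_smul _)).mul (φ.smooth ⊤)
  · refine HasCompactSupport.mul_right ?_
    exact χ.hasCompactSupport.comp_smul (by positivity)

theorem HasWeakDiv.schwartz_complex {u : ι → E N → ℝ} {m : ι → E N} {v : E N → ℝ}
    (h : HasWeakDiv u m v) (hu : ∀ i, MemLp (u i) 2 volume) (hv : MemLp v 2 volume)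
    (φ : 𝓢(E N, ℂ)) :
    ∑ i, ∫ x, (∂_{m i} φ) x * (u i x : ℂ) = -∫ x, φ x * (v x : ℂ) := by
  -- The real identity applied to `L ∘ φ`; it is used for the real and the imaginary part.
  have key : ∀ (L : ℂ →L[ℝ] ℝ), L (∑ i, ∫ x, (∂_{m i} φ) x * (u i x : ℂ))
      = L (-∫ x, φ x * (v x : ℂ)) := by
    intro L
    have hs := h.schwartz hu hv (SchwartzMap.postcompCLM L φ)
    have hreal : ∀ (f : 𝓢(E N, ℂ)) {w : E N → ℝ}, MemLp w 2 volume →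
        L (∫ x, f x * (w x : ℂ)) = ∫ x, w x * L (f x) := by
      intro f w hw
      rw [← L.integral_comp_comm]
      · refine integral_congr_ae (Eventually.of_forall fun x => ?_)
        have : f x * (w x : ℂ) = w x • f x := by
          rw [Complex.real_smul, mul_comm]
        simp only [this, map_smul, smul_eq_mul]
      · exact (f.memLp 2).integrable_mul hw.ofReal
    rw [map_sum, map_neg, hreal φ hv]
    simp_rw [fun i => hreal (∂_{m i} φ) (hu i)]
    have hd : ∀ x i, fderiv ℝ (SchwartzMap.postcompCLM L φ) x (m i) = L ((∂_{m i} φ) x) := by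
      intro x i
      have : (SchwartzMap.postcompCLM L φ : E N → ℝ) = fun x => L (φ x) := by
        ext y; simp
      have h2 : HasFDerivAt (fun x => L (φ x)) _ x := L.hasFDerivAt.comp x (φ.hasFDerivAt x)
      rw [this, h2.fderiv]
      simp [SchwartzMap.lineDerivOp_apply_eq_fderiv]
    simpa [hd] using hs
  apply Complex.ext
  · exact key Complex.reCLM
  · exact key Complex.imCLM

/-- The complex `L²` class of a real square integrable function. -/
def toL2 {u : E N → ℝ} (hu : MemLp u 2 volume) : Lp (α := E N) ℂ 2 volume :=
  (hu.ofReal (K := ℂ)).toLp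

theorem coeFn_toL2 {u : E N → ℝ} (hu : MemLp u 2 volume) :
    toL2 hu =ᵐ[volume] fun x => (u x : ℂ) := MemLp.coeFn_toLp _

theorem inner_toL2 {u v : E N → ℝ} (hu : MemLp u 2 volume) (hv : MemLp v 2 volume) :
    inner ℂ (toL2 hu) (toL2 hv) = ((∫ x, u x * v x : ℝ) : ℂ) := by
  rw [L2.inner_def, ← integral_complex_ofReal]
  refine integral_congr_ae ?_
  filter_upwards [coeFn_toL2 hu, coeFn_toL2 hv] with x h1 h2
  rw [h1, h2]
  simp [mul_comm]

/-- On the Fourier side a weak divergence in `L²` is multiplication by `2πi⟨ξ, m_i⟩`. -/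
theorem HasWeakDiv.fourier {u : ι → E N → ℝ} {m : ι → E N} {v : E N → ℝ}
    (h : HasWeakDiv u m v) (hu : ∀ i, MemLp (u i) 2 volume) (hv : MemLp v 2 volume) :
    ∀ᵐ ξ, (𝓕 (toL2 hv) : Lp (α := E N) ℂ 2 volume) ξ
      = ∑ i, (2 * Real.pi * Complex.I * (inner ℝ ξ (m i) : ℝ)) *
          (𝓕 (toL2 (hu i)) : Lp (α := E N) ℂ 2 volume) ξ := by
  have hdist : (Lp.toTemperedDistribution (toL2 hv) : 𝓢'(E N, ℂ))
      = ∑ i, ∂_{m i} (Lp.toTemperedDistribution (toL2 (hu i)) : 𝓢'(E N, ℂ)) := by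
    ext φ
    have hS := h.schwartz_complex hu hv φ
    -- Evaluation of the distribution of a real `L²` function.
    have hT : ∀ {w : E N → ℝ} (hw : MemLp w 2 volume) (ψ : 𝓢(E N, ℂ)),
        (Lp.toTemperedDistribution (toL2 hw) : 𝓢'(E N, ℂ)) ψ = ∫ x, ψ x * (w x : ℂ) := by
      intro w hw ψ
      rw [Lp.toTemperedDistribution_apply]
      refine integral_congr_ae ?_
      filter_upwards [coeFn_toL2 hw] with x hx
      rw [hx, smul_eq_mul]
    rw [hT, sum_apply]
    simp only [TemperedDistribution.lineDerivOp_apply_apply, hT, neg_apply, neg_mul,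
      integral_neg]
    rw [Finset.sum_neg_distrib, hS, neg_neg]
  have hF := congrArg (fun T : 𝓢'(E N, ℂ) => 𝓕 T) hdist
  simp only [FourierTransform.fourier_sum, TemperedDistribution.fourier_lineDerivOp_eq,
    Lp.fourier_toTemperedDistribution_eq] at hF
  set V : Lp (α := E N) ℂ 2 volume := 𝓕 (toL2 hv) with hV
  set U : ι → Lp (α := E N) ℂ 2 volume := fun i => 𝓕 (toL2 (hu i)) with hU
  have hloc : ∀ W : Lp (α := E N) ℂ 2 volume, LocallyIntegrable W volume := fun W =>
    (Lp.memLp W).locallyIntegrable (by norm_num)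
  have hcont : ∀ i, Continuous fun ξ : E N =>
      (2 * Real.pi * Complex.I * (inner ℝ ξ (m i) : ℝ) : ℂ) := fun i => by fun_prop
  have hlocU : ∀ i, LocallyIntegrable (fun ξ => (2 * Real.pi * Complex.I *
      (inner ℝ ξ (m i) : ℝ) : ℂ) * U i ξ) volume := fun i =>
    (hloc (U i)).continuous_smul (hcont i)
  refine ae_eq_of_integral_contDiff_smul_eq (hloc V) (locallyIntegrable_finsetSum _
    fun i _ => hlocU i) fun g hg hgc => ?_
  -- Test functions in `C_c^∞` suffice to identify two locally integrable functions.
  let φ : 𝓢(E N, ℂ) := SchwartzMap.postcompCLM Complex.ofRealCLM (hgc.toSchwartzMap hg)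
  have hφ : ∀ x, φ x = (g x : ℂ) := fun x => by
    simp [φ, SchwartzMap.postcompCLM_apply]
  have := congrArg (fun T : 𝓢'(E N, ℂ) => T φ) hF
  simp only [sum_apply, Lp.toTemperedDistribution_apply, smul_apply,
    TemperedDistribution.smulLeftCLM_apply_apply] at this
  simp_rw [← Complex.coe_smul, ← hφ]
  rw [this]
  simp_rw [Finset.smul_sum]
  rw [integral_finsetSum]
  · refine Finset.sum_congr rfl fun i _ => ?_
    rw [← integral_smul]
    refine integral_congr_ae (Eventually.of_forall fun x => ?_)
    have ht : (fun x : E N => ((inner ℝ x (m i) : ℝ) : ℂ)).HasTemperateGrowth := by fun_prop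
    simp only [SchwartzMap.smulLeftCLM_apply_apply ht, smul_eq_mul]
    ring
  · intro i _
    simp_rw [hφ, Complex.coe_smul]
    exact (hlocU i).integrable_smul_left_of_hasCompactSupport hg.continuous hgc

/-! ### Norms as integrals -/

theorem lnorm_two {F : Type*} [NormedAddCommGroup F] (f : E N → F) :
    lnorm f 2 = (eLpNorm f 2 volume).toReal := by
  simp [lnorm]

theorem lnorm_nonneg {F : Type*} [NormedAddCommGroup F] (f : E N → F) (q : ℝ) : 0 ≤ lnorm f q :=
  ENNReal.toReal_nonneg

theorem lnorm_rpow {F : Type*} [NormedAddCommGroup F] {f : E N → F} {q : ℝ} (hq : 0 < q)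
    (hf : MemLp f (ENNReal.ofReal q) volume) : lnorm f q ^ q = ∫ x, ‖f x‖ ^ q := by
  have h0 : 0 ≤ ∫ x, ‖f x‖ ^ q := integral_nonneg fun x => by positivity
  rw [lnorm, hf.eLpNorm_eq_integral_rpow_norm (by simpa using hq) ENNReal.ofReal_ne_top,
    ENNReal.toReal_ofReal hq.le, ENNReal.toReal_ofReal (by positivity), ← Real.rpow_mul h0,
    inv_mul_cancel₀ hq.ne', Real.rpow_one]

theorem lnorm_two_sq {F : Type*} [NormedAddCommGroup F] {f : E N → F}
    (hf : MemLp f 2 volume) : lnorm f 2 ^ 2 = ∫ x, ‖f x‖ ^ 2 := by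
  have := lnorm_rpow (q := 2) two_pos (by simpa using hf)
  simpa using this

theorem lnorm_two_sq_real {f : E N → ℝ} (hf : MemLp f 2 volume) :
    lnorm f 2 ^ 2 = ∫ x, f x ^ 2 := by
  simp [lnorm_two_sq hf]

theorem norm_toL2 {u : E N → ℝ} (hu : MemLp u 2 volume) : ‖toL2 hu‖ = lnorm u 2 := by
  rw [toL2, Lp.norm_toLp, lnorm_two]
  congr 1
  exact eLpNorm_congr_norm_ae (Eventually.of_forall fun x => by simp)

theorem abs_integral_mul_le_lnorm {u v : E N → ℝ} (hu : MemLp u 2 volume)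
    (hv : MemLp v 2 volume) : |∫ x, u x * v x| ≤ lnorm u 2 * lnorm v 2 := by
  have h := norm_inner_le_norm (𝕜 := ℂ) (toL2 hu) (toL2 hv)
  rwa [inner_toL2, norm_toL2, norm_toL2, Complex.norm_real, Real.norm_eq_abs] at h

/-! ### Green's formula in `H²` -/

theorem H2.hasWeakDiv_coord (u : H2 N) (y : E N) :
    HasWeakDiv (fun _ : Unit => u.toFun) (fun _ => y) (fun x => inner ℝ (u.grad x) y) := by
  intro φ hφ hc
  simpa using u.hasWeakGradient φ hφ hc y

/-- The weak Laplacian is the weak divergence of the weak gradient: in `∫ u Δφ` one derivative at a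
time is moved to `u`, using `∂_{b_i} φ` as a test function for the weak gradient. -/
theorem H2.hasWeakDiv_grad (u : H2 N) (b : OrthonormalBasis ι ℝ (E N)) :
    HasWeakDiv (fun i x => inner ℝ (u.grad x) (b i)) b u.lap := by
  intro φ hφ hc
  let ψ : 𝓢(E N, ℝ) := hc.toSchwartzMap hφ
  have hcψ : ∀ i, HasCompactSupport ((∂_{b i} ψ : 𝓢(E N, ℝ)) : E N → ℝ) := fun i =>
    hc.mono' ((subset_tsupport _).trans (SchwartzMap.tsupport_lineDerivOp_subset (b i) ψ))
  have h1 : ∀ i, ∫ x, inner ℝ (u.grad x) (b i) * fderiv ℝ φ x (b i)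
      = -∫ x, u.toFun x * (∂_{b i} (∂_{b i} ψ) : 𝓢(E N, ℝ)) x := by
    intro i
    have := u.hasWeakGradient (∂_{b i} ψ : 𝓢(E N, ℝ))
      ((∂_{b i} ψ : 𝓢(E N, ℝ)).smooth ⊤) (hcψ i) (b i)
    simp only [SchwartzMap.lineDerivOp_apply_eq_fderiv] at this ⊢
    rw [this, neg_neg]
    rfl
  have h2 := u.hasWeakLaplacian φ hφ hc
  rw [← h2, Finset.sum_congr rfl fun i _ => h1 i, Finset.sum_neg_distrib, ← integral_finsetSum]
  · congr 1
    refine integral_congr_ae (Eventually.of_forall fun x => ?_)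
    simp only [← Finset.mul_sum]
    congr 1
    have := SchwartzMap.laplacian_apply ψ x
    rw [SchwartzMap.laplacian_eq_sum b, sum_apply] at this
    exact this
  · intro i _
    exact u.memLp_toFun.integrable_mul ((∂_{b i} (∂_{b i} ψ) : 𝓢(E N, ℝ)).memLp 2 volume)

theorem H2.memLp_inner_grad (u : H2 N) (y : E N) :
    MemLp (fun x => inner ℝ (u.grad x) y) 2 volume :=
  u.memLp_grad.inner_const y

/-- Green's formula `‖∇u‖₂² = -∫ u Δu` for `u ∈ H²`. By Plancherel both sides are the integral of
`4π²|ξ|²|û|²`. -/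
theorem H2.lnorm_grad_sq (u : H2 N) :
    lnorm u.grad 2 ^ 2 = -∫ x, u.toFun x * u.lap x := by
  let b := stdOrthonormalBasis ℝ (E N)
  have hg := fun i => u.memLp_inner_grad (b i)
  have h1 : lnorm u.grad 2 ^ 2
      = ∑ i, ∫ x, inner ℝ (u.grad x) (b i) * inner ℝ (u.grad x) (b i) := by
    rw [lnorm_two_sq u.memLp_grad, ← integral_finsetSum]
    · refine integral_congr_ae (Eventually.of_forall fun x => ?_)
      simp only [← pow_two, b.sum_sq_inner_left]
    · exact fun i _ => (hg i).integrable_mul (hg i)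
  have hG := fun i => (u.hasWeakDiv_coord (b i)).fourier (fun _ => u.memLp_toFun) (hg i)
  have hW := (u.hasWeakDiv_grad b).fourier hg u.memLp_lap
  have h2 : ∑ i, inner ℂ (𝓕 (toL2 (hg i))) (𝓕 (toL2 (hg i)))
      = -inner ℂ (𝓕 (toL2 u.memLp_lap)) (𝓕 (toL2 u.memLp_toFun)) := by
    simp only [L2.inner_def]
    rw [← integral_neg, ← integral_finsetSum]
    · refine integral_congr_ae ?_
      filter_upwards [hW, ae_all_iff.2 hG] with ξ h1 h2
      rw [h1]
      simp only [RCLike.inner_apply, map_sum, map_mul, Complex.conj_ofReal, Complex.conj_I,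
        Finset.mul_sum, ← Finset.sum_neg_distrib]
      refine Finset.sum_congr rfl fun i _ => ?_
      conv_lhs => rw [mul_comm]
      conv_lhs => enter [2]; rw [h2 i]
      have h3 : (starRingEnd ℂ) 2 = 2 := map_ofNat _ 2
      simp [h3]
      ring
    · exact fun i _ => L2.integrable_inner _ _
  simp only [Lp.inner_fourier_eq, inner_toL2] at h2
  rw [h1, ← Complex.ofReal_inj]
  push_cast at h2 ⊢
  rw [h2]
  simp only [mul_comm]

theorem H2.lnorm_grad_sq_le (u : H2 N) :
    lnorm u.grad 2 ^ 2 ≤ lnorm u.toFun 2 * lnorm u.lap 2 := by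
  rw [u.lnorm_grad_sq]
  exact (neg_le_abs _).trans (abs_integral_mul_le_lnorm u.memLp_toFun u.memLp_lap)

/-! ### Lower bound of the energy -/

/-- The Gagliardo–Nirenberg inequality recovered from the supremum of the quotients. The range of
`gam N p` keeps the denominators finite; where a denominator vanishes, a finite quotient in
`[0, ∞]` forces the numerator to vanish as well. -/
theorem lnorm_le_of_bestGN {p C : ℝ} (hγ0 : 0 ≤ gam N p) (hγ1 : gam N p ≤ 1)
    (hCpos : 0 < C) (hC : bestGN N p ≤ ENNReal.ofReal C) (u : H2 N) :
    lnorm u.toFun p ≤ C * (lnorm u.toFun 2 ^ (1 - gam N p) * lnorm u.lap 2 ^ gam N p) := by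
  have h1 := (le_iSup (fun u : H2 N => eLpNorm u.toFun (ENNReal.ofReal p) volume /
    (eLpNorm u.toFun 2 volume ^ (1 - gam N p) * eLpNorm u.lap 2 volume ^ gam N p)) u).trans hC
  have hfin : eLpNorm u.toFun 2 volume ^ (1 - gam N p) * eLpNorm u.lap 2 volume ^ gam N p ≠ ⊤ :=
    ENNReal.mul_ne_top (ENNReal.rpow_ne_top_of_nonneg (by linarith) u.memLp_toFun.2.ne)
      (ENNReal.rpow_ne_top_of_nonneg hγ0 u.memLp_lap.2.ne)
  rw [ENNReal.div_le_iff_le_mul (Or.inr ENNReal.ofReal_ne_top) (Or.inl hfin)] at h1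
  have h2 := ENNReal.toReal_mono (ENNReal.mul_ne_top ENNReal.ofReal_ne_top hfin) h1
  rw [ENNReal.toReal_mul, ENNReal.toReal_mul, ENNReal.toReal_ofReal hCpos.le,
    ← ENNReal.toReal_rpow, ← ENNReal.toReal_rpow] at h2
  rw [lnorm_two, lnorm_two]
  exact h2

/-- The functional `‖Δu‖₂² - 2κ‖∇u‖₂² - θ‖u‖_p^p`, of which both energies are multiples. -/
def genEnergy (p κ θ : ℝ) (u : H2 N) : ℝ :=
  lnorm u.lap 2 ^ 2 - 2 * κ * lnorm u.grad 2 ^ 2 - θ * lnorm u.toFun p ^ p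

theorem bddBelow_genEnergy {p C κ θ : ℝ} (hp : 0 ≤ p) (hγ0 : 0 ≤ gam N p) (hγ1 : gam N p ≤ 1)
    (hCpos : 0 < C) (hC : bestGN N p ≤ ENNReal.ofReal C) (hκ : 0 ≤ κ) (hθ : 0 ≤ θ)
    {b : ℝ} (hb : 0 ≤ b) (R : ℝ) : BddBelow (genEnergy p κ θ '' ballA N b R) := by
  refine ⟨0 - 2 * κ * (b * R) - θ * (C * (b ^ (1 - gam N p) * R ^ gam N p)) ^ p, ?_⟩
  rintro _ ⟨u, ⟨hu, huR⟩, rfl⟩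
  have hub : lnorm u.toFun 2 = b := (sq_eq_sq₀ (lnorm_nonneg _ _) hb).1 hu
  have h0 := lnorm_nonneg u.lap 2
  have h1 : lnorm u.grad 2 ^ 2 ≤ b * R := by
    refine u.lnorm_grad_sq_le.trans ?_
    rw [hub]
    exact mul_le_mul_of_nonneg_left huR.le hb
  have h2 : lnorm u.toFun p ^ p ≤ (C * (b ^ (1 - gam N p) * R ^ gam N p)) ^ p := by
    refine Real.rpow_le_rpow (lnorm_nonneg _ _) ?_ hp
    refine (lnorm_le_of_bestGN hγ0 hγ1 hCpos hC u).trans ?_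
    rw [hub]
    gcongr
  have h3 := mul_le_mul_of_nonneg_left h1 (by positivity : 0 ≤ 2 * κ)
  have h4 := mul_le_mul_of_nonneg_left h2 hθ
  have h5 := sq_nonneg (lnorm u.lap 2)
  unfold genEnergy
  linarith

/-! ### Inverse Fourier transforms of real Schwartz functions -/

/-- A real Schwartz function as an element of `H²`, with its classical derivatives. -/
def H2.ofSchwartz (u : 𝓢(E N, ℝ)) : H2 N where
  toFun := u
  grad := gradient u
  lap := (Δ u : 𝓢(E N, ℝ))
  memLp_toFun := u.memLp 2
  memLp_grad := by
    have h : MemLp (fderiv ℝ u) 2 volume := (SchwartzMap.fderivCLM ℝ (E N) ℝ u).memLp 2 volume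
    refine h.of_le ?_ (Eventually.of_forall fun x => ?_)
    · have : Continuous (fderiv ℝ u) := (SchwartzMap.fderivCLM ℝ (E N) ℝ u).continuous
      exact ((InnerProductSpace.toDual ℝ (E N)).symm.continuous.comp this).aestronglyMeasurable
    · simp [gradient]
  memLp_lap := (Δ u : 𝓢(E N, ℝ)).memLp 2
  hasWeakGradient := by
    intro φ hφ hc y
    have := SchwartzMap.integral_mul_lineDerivOp_right_eq_neg_left (μ := volume) u
      (hc.toSchwartzMap hφ) y
    have hco : ⇑(hc.toSchwartzMap hφ) = φ := rfl
    simpa [SchwartzMap.lineDerivOp_apply_eq_fderiv, hco] using this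
  hasWeakLaplacian := by
    intro φ hφ hc
    have := SchwartzMap.integral_mul_laplacian_right_eq_left (μ := volume) u (hc.toSchwartzMap hφ)
    have hco : ⇑(hc.toSchwartzMap hφ) = φ := rfl
    simpa [SchwartzMap.laplacian_apply, hco] using this

/-- The complex inverse Fourier transform of a real Schwartz function. -/
def cFourierInv (η : 𝓢(E N, ℝ)) : 𝓢(E N, ℂ) := 𝓕⁻ (SchwartzMap.postcompCLM Complex.ofRealCLM η)

/-- The real part of the inverse Fourier transform of a real Schwartz function. -/
def reFourierInv (η : 𝓢(E N, ℝ)) : 𝓢(E N, ℝ) :=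
  SchwartzMap.postcompCLM Complex.reCLM (cFourierInv η)

theorem cFourierInv_apply (η : 𝓢(E N, ℝ)) (x : E N) :
    cFourierInv η x
      = ∫ ξ, Complex.exp ((2 * Real.pi * inner ℝ ξ x : ℝ) * Complex.I) * (η ξ : ℂ) := by
  rw [cFourierInv, SchwartzMap.fourierInv_coe, Real.fourierInv_eq']
  simp

theorem integrable_exp_mul (η : 𝓢(E N, ℝ)) (x : E N) : Integrable (fun ξ =>
    Complex.exp ((2 * Real.pi * inner ℝ ξ x : ℝ) * Complex.I) * (η ξ : ℂ)) volume := by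
  refine (η.integrable (μ := volume)).norm.mono' ?_ (Eventually.of_forall fun ξ => ?_)
  · have := η.continuous
    exact (by fun_prop : Continuous _).aestronglyMeasurable
  · rw [norm_mul, Complex.norm_exp_ofReal_mul_I, one_mul, Complex.norm_real]

theorem reFourierInv_apply (η : 𝓢(E N, ℝ)) (x : E N) :
    reFourierInv η x = ∫ ξ, Real.cos (2 * Real.pi * inner ℝ ξ x) * η ξ := by
  have h1 : reFourierInv η x = Complex.reCLM (cFourierInv η x) := rfl
  rw [h1, cFourierInv_apply, ← Complex.reCLM.integral_comp_comm (integrable_exp_mul η x)]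
  refine integral_congr_ae (Eventually.of_forall fun ξ => ?_)
  simp only [Complex.reCLM_apply, Complex.mul_re, Complex.ofReal_re, Complex.ofReal_im,
    Complex.exp_ofReal_mul_I_re, mul_zero, sub_zero]

/-- The inverse Fourier transform of an even real function is real. -/
theorem ofReal_reFourierInv {η : 𝓢(E N, ℝ)} (hη : ∀ ξ, η (-ξ) = η ξ) (x : E N) :
    (reFourierInv η x : ℂ) = cFourierInv η x := by
  have h1 : reFourierInv η x = (cFourierInv η x).re := rfl
  rw [h1, ← Complex.conj_eq_iff_re, cFourierInv_apply, ← integral_conj, ← integral_neg_eq_self]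
  refine integral_congr_ae (Eventually.of_forall fun ξ => ?_)
  simp only [map_mul, Complex.conj_ofReal, ← Complex.exp_conj, Complex.conj_I, hη,
    inner_neg_left]
  congr 2
  push_cast
  ring

theorem reFourierInv_eq_of_norm_eq {η : 𝓢(E N, ℝ)} (hη : ∀ ξ ζ, ‖ξ‖ = ‖ζ‖ → η ξ = η ζ)
    {x y : E N} (hxy : ‖x‖ = ‖y‖) : reFourierInv η x = reFourierInv η y := by
  let A : E N ≃ₗᵢ[ℝ] E N := (ℝ ∙ (x - y))ᗮ.reflection
  have hA : A x = y := Submodule.reflection_sub hxy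
  rw [reFourierInv_apply, reFourierInv_apply, ← hA,
    ← A.measurePreserving.integral_comp A.toHomeomorph.measurableEmbedding
      (fun ξ => Real.cos (2 * Real.pi * inner ℝ ξ (A x)) * η ξ)]
  refine integral_congr_ae (Eventually.of_forall fun ξ => ?_)
  simp only
  rw [A.inner_map_map, hη (A ξ) ξ (A.norm_map ξ)]

theorem integral_reFourierInv_sq {η : 𝓢(E N, ℝ)} (hη : ∀ ξ, η (-ξ) = η ξ) :
    ∫ x, reFourierInv η x ^ 2 = ∫ ξ, η ξ ^ 2 := by
  have h := SchwartzMap.integral_norm_sq_fourier (cFourierInv η)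
  rw [cFourierInv, FourierTransform.fourier_fourierInv_eq] at h
  have h2 : ∀ ξ, ‖SchwartzMap.postcompCLM Complex.ofRealCLM η ξ‖ ^ 2 = η ξ ^ 2 := fun ξ => by
    simp
  simp only [h2] at h
  rw [h]
  refine integral_congr_ae (Eventually.of_forall fun x => ?_)
  change reFourierInv η x ^ 2 = ‖cFourierInv η x‖ ^ 2
  rw [← ofReal_reFourierInv hη, Complex.norm_real, Real.norm_eq_abs, sq_abs]

theorem hasTemperateGrowth_norm_sq : (fun ξ : E N => ‖ξ‖ ^ 2).HasTemperateGrowth := by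
  fun_prop

/-- The operator `Δ + κ` is the Fourier multiplier `κ - 4π²|ξ|²`. -/
theorem laplacian_add_reFourierInv (η : 𝓢(E N, ℝ)) (κ : ℝ) :
    (Δ (reFourierInv η) : 𝓢(E N, ℝ)) + κ • reFourierInv η = reFourierInv
      (κ • η - (4 * Real.pi ^ 2) • SchwartzMap.smulLeftCLM ℝ (fun ξ : E N => ‖ξ‖ ^ 2) η) := by
  have hM : SchwartzMap.smulLeftCLM ℂ (fun ξ : E N => ‖ξ‖ ^ 2)
      (SchwartzMap.postcompCLM Complex.ofRealCLM η) = SchwartzMap.postcompCLM Complex.ofRealCLM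
        (SchwartzMap.smulLeftCLM ℝ (fun ξ : E N => ‖ξ‖ ^ 2) η) := by
    ext ξ
    simp [SchwartzMap.smulLeftCLM_apply_apply hasTemperateGrowth_norm_sq]
  have hL : (Δ (cFourierInv η) : 𝓢(E N, ℂ)) = -(2 * Real.pi) ^ 2 •
      cFourierInv (SchwartzMap.smulLeftCLM ℝ (fun ξ : E N => ‖ξ‖ ^ 2) η) := by
    rw [SchwartzMap.laplacian_eq_fourierMultiplierCLM, SchwartzMap.fourierMultiplierCLM_apply,
      cFourierInv, FourierTransform.fourier_fourierInv_eq, cFourierInv, ← hM]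
  have hlin : cFourierInv (κ • η - (4 * Real.pi ^ 2) •
      SchwartzMap.smulLeftCLM ℝ (fun ξ : E N => ‖ξ‖ ^ 2) η) =
      κ • cFourierInv η + (Δ (cFourierInv η) : 𝓢(E N, ℂ)) := by
    rw [hL]
    unfold cFourierInv
    rw [map_sub, map_smul, map_smul, sub_eq_add_neg, ← neg_smul, FourierTransform.fourierInv_add,
      FourierTransform.fourierInv_smul, FourierTransform.fourierInv_smul]
    ring_nf
  ext x
  have h1 : (Δ (reFourierInv η) : 𝓢(E N, ℝ)) x
      = Complex.reCLM ((Δ (cFourierInv η) : 𝓢(E N, ℂ)) x) := by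
    rw [SchwartzMap.laplacian_apply, SchwartzMap.laplacian_apply]
    exact ((cFourierInv η).smooth 2).contDiffAt.laplacian_CLM_comp_left (l := Complex.reCLM)
  rw [add_apply, h1]
  change _ = Complex.reCLM (cFourierInv _ x)
  rw [hlin, add_apply, map_add, add_comm]
  congr 1
  rw [smul_apply, smul_apply, map_smul]
  rfl

theorem integral_laplacian_add_sq {η : 𝓢(E N, ℝ)} (hη : ∀ ξ, η (-ξ) = η ξ) (κ : ℝ) :
    ∫ x, ((Δ (reFourierInv η) : 𝓢(E N, ℝ)) x + κ * reFourierInv η x) ^ 2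
      = ∫ ξ, ((κ - 4 * Real.pi ^ 2 * ‖ξ‖ ^ 2) * η ξ) ^ 2 := by
  have h1 : ∀ ξ, (κ • η - (4 * Real.pi ^ 2) •
      SchwartzMap.smulLeftCLM ℝ (fun ξ : E N => ‖ξ‖ ^ 2) η) ξ
        = (κ - 4 * Real.pi ^ 2 * ‖ξ‖ ^ 2) * η ξ := by
    intro ξ
    simp [SchwartzMap.smulLeftCLM_apply_apply hasTemperateGrowth_norm_sq]
    ring
  have h2 := integral_reFourierInv_sq (η := κ • η - (4 * Real.pi ^ 2) •
      SchwartzMap.smulLeftCLM ℝ (fun ξ : E N => ‖ξ‖ ^ 2) η) (fun ξ => by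
        rw [h1, h1, norm_neg, hη])
  rw [← laplacian_add_reFourierInv] at h2
  simp only [h1] at h2
  simpa using h2

/-- Near the origin no cancellation occurs in the inverse Fourier transform of a nonnegative
function of compact support. -/
theorem half_integral_le_reFourierInv {η : 𝓢(E N, ℝ)} (h0 : ∀ ξ, 0 ≤ η ξ) {r : ℝ}
    (hr : ∀ ξ, η ξ ≠ 0 → 2 * Real.pi * ‖ξ‖ * r ≤ 1) {x : E N} (hx : ‖x‖ ≤ r) :
    (∫ ξ, η ξ) / 2 ≤ reFourierInv η x := by
  rw [reFourierInv_apply, ← integral_div]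
  refine integral_mono (η.integrable.div_const 2) ?_ fun ξ => ?_
  · refine (η.integrable (μ := volume)).norm.mono' ?_ (Eventually.of_forall fun ξ => ?_)
    · have := η.continuous
      exact (by fun_prop : Continuous _).aestronglyMeasurable
    · rw [norm_mul]
      exact mul_le_of_le_one_left (norm_nonneg _) (Real.abs_cos_le_one _)
  · by_cases h : η ξ = 0
    · simp [h]
    have h1 : |2 * Real.pi * inner ℝ ξ x| ≤ 1 := by
      rw [abs_mul, abs_of_nonneg (by positivity : (0 : ℝ) ≤ 2 * Real.pi)]
      calc 2 * Real.pi * |inner ℝ ξ x| ≤ 2 * Real.pi * (‖ξ‖ * r) := by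
            gcongr
            exact (abs_real_inner_le_norm ξ x).trans (by gcongr)
        _ ≤ 1 := by rw [← mul_assoc]; exact hr ξ h
    have h2 : (2 * Real.pi * inner ℝ ξ x) ^ 2 ≤ 1 := by
      rw [← sq_abs]; exact pow_le_one₀ (abs_nonneg _) h1
    have h3 : 1 / 2 ≤ Real.cos (2 * Real.pi * inner ℝ ξ x) :=
      le_trans (by linarith) Real.one_sub_sq_div_two_le_cos
    have := mul_le_mul_of_nonneg_right h3 (h0 ξ)
    simp only
    linarith

/-! ### Frequency shells -/

/-- The one-dimensional profile: `1` on `[-1/2, 1/2]`, `0` outside `(-1, 1)`. -/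
def bandProfile : ContDiffBump (0 : ℝ) := ⟨1 / 2, 1, by norm_num, by norm_num⟩

/-- A smooth radial cutoff to the shell `|4π²|ξ|² - κ| < ε`, equal to `1` on the shell of half
the width. -/
def bandFun (N : ℕ) (κ ε : ℝ) (ξ : E N) : ℝ :=
  bandProfile (ε⁻¹ * (4 * Real.pi ^ 2 * ‖ξ‖ ^ 2 - κ))

theorem abs_lt_of_bandFun_ne_zero {κ ε : ℝ} (hε : 0 < ε) {ξ : E N} (h : bandFun N κ ε ξ ≠ 0) :
    |4 * Real.pi ^ 2 * ‖ξ‖ ^ 2 - κ| < ε := by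
  have h1 : ε⁻¹ * (4 * Real.pi ^ 2 * ‖ξ‖ ^ 2 - κ) ∈ Function.support bandProfile := h
  rw [bandProfile.support_eq, mem_ball_zero_iff, Real.norm_eq_abs, abs_mul,
    abs_of_pos (inv_pos.2 hε)] at h1
  have h2 : ε⁻¹ * |4 * Real.pi ^ 2 * ‖ξ‖ ^ 2 - κ| < 1 := h1
  rwa [inv_mul_lt_iff₀ hε, mul_one] at h2

theorem bandFun_eq_one {κ ε : ℝ} (hε : 0 < ε) {ξ : E N}
    (h : |4 * Real.pi ^ 2 * ‖ξ‖ ^ 2 - κ| ≤ ε / 2) : bandFun N κ ε ξ = 1 := by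
  refine bandProfile.one_of_mem_closedBall ?_
  rw [mem_closedBall_zero_iff, Real.norm_eq_abs, abs_mul, abs_of_pos (inv_pos.2 hε)]
  change _ ≤ (1 / 2 : ℝ)
  rw [inv_mul_le_iff₀ hε]
  linarith

theorem norm_le_of_bandFun_ne_zero {κ ε : ℝ} (hε : 0 < ε) (hε1 : ε ≤ 1) {ξ : E N}
    (h : bandFun N κ ε ξ ≠ 0) : 2 * Real.pi * ‖ξ‖ ≤ √(κ + 1) := by
  have h1 := (abs_lt.1 (abs_lt_of_bandFun_ne_zero hε h)).2
  refine Real.le_sqrt_of_sq_le ?_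
  nlinarith

theorem contDiff_bandFun (κ ε : ℝ) : ContDiff ℝ ∞ (bandFun N κ ε) :=
  bandProfile.contDiff.comp
    (contDiff_const.mul ((contDiff_const.mul (contDiff_norm_sq ℝ)).sub contDiff_const))

theorem hasCompactSupport_bandFun {κ ε : ℝ} (hε : 0 < ε) (hε1 : ε ≤ 1) :
    HasCompactSupport (bandFun N κ ε) := by
  refine HasCompactSupport.intro (isCompact_closedBall (0 : E N) (√(κ + 1) / (2 * Real.pi)))
    fun ξ hξ => ?_
  by_contra h
  refine hξ ?_
  rw [mem_closedBall_zero_iff, le_div_iff₀ (by positivity), mul_comm]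
  exact norm_le_of_bandFun_ne_zero hε hε1 h

/-- The shell around the sphere `4π²|ξ|² = κ` has volume at least proportional to its width. -/
theorem exists_mul_le_volume_shell (hN : 2 ≤ N) {κ : ℝ} (hκ : 0 < κ) : ∃ c > 0, ∀ ε > 0,
    c * ε ≤ volume.real {ξ : E N | |4 * Real.pi ^ 2 * ‖ξ‖ ^ 2 - κ| ≤ ε / 2} := by
  set V₁ := volume.real (Metric.ball (0 : E N) 1) with hV
  have hVpos : 0 < V₁ :=
    ENNReal.toReal_pos (Metric.measure_ball_pos volume _ one_pos).ne' measure_ball_lt_top.ne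
  have hpi := Real.pi_pos
  set r := √κ / (2 * Real.pi) with hr
  have hrpos : 0 < r := by positivity
  have hr2 : 4 * Real.pi ^ 2 * r ^ 2 = κ := by
    rw [hr, div_pow, Real.sq_sqrt hκ.le]; field_simp; ring
  refine ⟨r ^ (N - 2) / (8 * Real.pi ^ 2) * V₁, by positivity, fun ε hε => ?_⟩
  set R := √(κ + ε / 2) / (2 * Real.pi) with hR
  have hRpos : 0 < R := by positivity
  have hR2 : 4 * Real.pi ^ 2 * R ^ 2 = κ + ε / 2 := by
    rw [hR, div_pow, Real.sq_sqrt (by positivity)]; field_simp; ring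
  have hrR : r ≤ R := by
    rw [hr, hR]; gcongr; linarith
  set S := {ξ : E N | |4 * Real.pi ^ 2 * ‖ξ‖ ^ 2 - κ| ≤ ε / 2}
  have hfin : volume S ≠ ⊤ := by
    refine ((measure_mono fun ξ hξ => ?_).trans_lt
      (measure_closedBall_lt_top (x := (0 : E N)) (r := R))).ne
    rw [mem_closedBall_zero_iff]
    have hξ' : |4 * Real.pi ^ 2 * ‖ξ‖ ^ 2 - κ| ≤ ε / 2 := hξ
    have := (abs_le.1 hξ').2
    refine (sq_le_sq₀ (norm_nonneg _) hRpos.le).1 ?_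
    have h4 : (0 : ℝ) < 4 * Real.pi ^ 2 := by positivity
    nlinarith
  have hsub : Metric.ball (0 : E N) R \ Metric.ball 0 r ⊆ S := by
    rintro ξ ⟨h1, h2⟩
    rw [mem_ball_zero_iff] at h1 h2
    rw [not_lt] at h2
    have h3 : r ^ 2 ≤ ‖ξ‖ ^ 2 := by gcongr
    have h4 : ‖ξ‖ ^ 2 ≤ R ^ 2 := by gcongr
    have h5 := mul_le_mul_of_nonneg_left h3 (by positivity : 0 ≤ 4 * Real.pi ^ 2)
    have h6 := mul_le_mul_of_nonneg_left h4 (by positivity : 0 ≤ 4 * Real.pi ^ 2)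
    change |4 * Real.pi ^ 2 * ‖ξ‖ ^ 2 - κ| ≤ ε / 2
    exact abs_le.2 ⟨by linarith, by linarith⟩
  have hball : ∀ ρ : ℝ, 0 < ρ → volume.real (Metric.ball (0 : E N) ρ) = ρ ^ N * V₁ := by
    intro ρ hρ
    rw [measureReal_def, Measure.addHaar_ball_of_pos _ _ hρ, ENNReal.toReal_mul,
      ENNReal.toReal_ofReal (by positivity), finrank_euclideanSpace_fin, hV, measureReal_def]
  have h1 := measureReal_mono hsub hfin
  -- The shell contains `B_R \ B_r`, and `R^N - r^N ≥ r^(N-2) (R² - r²)`.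
  rw [measureReal_sdiff (Metric.ball_subset_ball hrR) measurableSet_ball, hball _ hrpos,
    hball _ hRpos] at h1
  refine le_trans ?_ h1
  rw [← sub_mul, mul_right_comm]
  refine mul_le_mul_of_nonneg_right ?_ hVpos.le
  have h2 : ∀ ρ : ℝ, ρ ^ N = ρ ^ (N - 2) * ρ ^ 2 := fun ρ => by
    rw [← pow_add]; congr 1; omega
  have h3 : r ^ (N - 2) * R ^ 2 ≤ R ^ (N - 2) * R ^ 2 := by gcongr
  have h4 : R ^ 2 - r ^ 2 = ε / (8 * Real.pi ^ 2) := by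
    field_simp
    linarith
  calc r ^ (N - 2) / (8 * Real.pi ^ 2) * ε = r ^ (N - 2) * (R ^ 2 - r ^ 2) := by rw [h4]; ring
    _ ≤ R ^ N - r ^ N := by rw [h2 R, h2 r]; linarith

/-- Radial functions of mass `b²` whose frequencies concentrate on the sphere `4π²|ξ|² = κ` at
rate `ε`. They are `s • 𝓕⁻η` with `η` the cutoff to the shell and `s = b / ‖η‖₂`. On the ball of
radius `1 / √(κ + 1)` one has `s 𝓕⁻η ≥ s ‖η‖₁ / 2 ≥ b ‖η‖₂ / 2`, as `0 ≤ η ≤ 1`, and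
`‖η‖₂² ≥ c ε`. -/
theorem exists_schwartz_concentrating (hN : 2 ≤ N) {p κ b : ℝ} (hp : 0 < p) (hκ : 0 < κ)
    (hb : 0 < b) : ∃ c > 0, ∀ ε : ℝ, 0 < ε → ε ≤ 1 → ∃ u : 𝓢(E N, ℝ),
      (∃ f : ℝ → ℝ, ∀ x, u x = f ‖x‖) ∧ ∫ x, u x ^ 2 = b ^ 2 ∧
      ∫ x, ((Δ u : 𝓢(E N, ℝ)) x + κ * u x) ^ 2 ≤ ε ^ 2 * b ^ 2 ∧
      c * ε ^ (p / 2) ≤ ∫ x, ‖u x‖ ^ p := by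
  obtain ⟨c, hc, hvol⟩ := exists_mul_le_volume_shell hN hκ
  set r := 1 / √(κ + 1) with hr
  have hrpos : 0 < r := by positivity
  set V := volume.real (Metric.closedBall (0 : E N) r) with hV
  have hVpos : 0 < V := ENNReal.toReal_pos
    (Metric.measure_closedBall_pos volume _ hrpos).ne' measure_closedBall_lt_top.ne
  refine ⟨V * ((b / 2) ^ p * c ^ (p / 2)), by positivity, fun ε hε hε1 => ?_⟩
  let η : 𝓢(E N, ℝ) :=
    (hasCompactSupport_bandFun (N := N) (κ := κ) hε hε1).toSchwartzMap (contDiff_bandFun κ ε)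
  have hη : ∀ ξ, η ξ = bandFun N κ ε ξ := fun _ => rfl
  have hη0 : ∀ ξ, 0 ≤ η ξ := fun ξ => bandProfile.nonneg
  have hη1 : ∀ ξ, η ξ ≤ 1 := fun ξ => bandProfile.le_one
  have hrad : ∀ ξ ζ, ‖ξ‖ = ‖ζ‖ → η ξ = η ζ := fun ξ ζ h => by
    rw [hη, hη, bandFun, bandFun, h]
  have heven : ∀ ξ, η (-ξ) = η ξ := fun ξ => hrad _ _ (norm_neg ξ)
  have hint2 : Integrable (fun ξ => η ξ ^ 2) volume := (η.memLp 2 volume).integrable_sq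
  set J := ∫ ξ, η ξ ^ 2 with hJ
  have hJI : J ≤ ∫ ξ, η ξ := integral_mono hint2 η.integrable fun ξ => by
    simpa [pow_two] using mul_le_of_le_one_left (hη0 ξ) (hη1 ξ)
  have hcJ : c * ε ≤ J := by
    refine (hvol ε hε).trans ?_
    set S := {ξ : E N | |4 * Real.pi ^ 2 * ‖ξ‖ ^ 2 - κ| ≤ ε / 2}
    have hS : MeasurableSet S :=
      (isClosed_le (by fun_prop) continuous_const).measurableSet
    calc volume.real S = ∫ ξ in S, (1 : ℝ) := by simp
      _ = ∫ ξ in S, η ξ ^ 2 := setIntegral_congr_fun hS fun ξ hξ => by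
          simp only [hη, bandFun_eq_one hε hξ, one_pow]
      _ ≤ J := setIntegral_le_integral hint2 (Eventually.of_forall fun ξ => sq_nonneg _)
  have hJpos : 0 < J := lt_of_lt_of_le (by positivity) hcJ
  set s := b / √J with hs
  have hspos : 0 < s := by positivity
  have hsJ : s ^ 2 * J = b ^ 2 := by
    rw [hs, div_pow, Real.sq_sqrt hJpos.le, div_mul_cancel₀ _ hJpos.ne']
  have hus : ∀ x, (s • reFourierInv η) x = s * reFourierInv η x := fun x => rfl
  have hlap : ∀ x, (Δ (s • reFourierInv η) : 𝓢(E N, ℝ)) x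
      = s * (Δ (reFourierInv η) : 𝓢(E N, ℝ)) x := fun x => by
    rw [← SchwartzMap.laplacianCLM_eq', map_smul, SchwartzMap.laplacianCLM_eq']; rfl
  refine ⟨s • reFourierInv η, ⟨fun t => s * reFourierInv η
    (t • EuclideanSpace.single ⟨0, by omega⟩ 1), fun x => ?_⟩, ?_, ?_, ?_⟩
  · rw [hus]
    congr 1
    exact reFourierInv_eq_of_norm_eq hrad (by simp [norm_smul])
  · simp only [hus, mul_pow, integral_const_mul]
    rw [integral_reFourierInv_sq heven, hsJ]
  · have h1 : ∀ x, ((Δ (s • reFourierInv η) : 𝓢(E N, ℝ)) x + κ * (s • reFourierInv η) x) ^ 2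
        = s ^ 2 * ((Δ (reFourierInv η) : 𝓢(E N, ℝ)) x + κ * reFourierInv η x) ^ 2 := fun x => by
      rw [hlap, hus]; ring
    simp only [h1, integral_const_mul]
    rw [integral_laplacian_add_sq heven]
    have h2 : ∫ ξ, ((κ - 4 * Real.pi ^ 2 * ‖ξ‖ ^ 2) * η ξ) ^ 2 ≤ ε ^ 2 * J := by
      rw [hJ, ← integral_const_mul]
      refine integral_mono_of_nonneg (Eventually.of_forall fun ξ => sq_nonneg _)
        (hint2.const_mul _) (Eventually.of_forall fun ξ => ?_)
      simp only [mul_pow]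
      by_cases h : η ξ = 0
      · simp [h]
      refine mul_le_mul_of_nonneg_right ?_ (sq_nonneg _)
      refine sq_le_sq' ?_ ?_ <;>
        have := abs_lt.1 (abs_lt_of_bandFun_ne_zero hε h) <;> linarith
    calc _ ≤ s ^ 2 * (ε ^ 2 * J) := by gcongr
      _ = ε ^ 2 * b ^ 2 := by rw [← hsJ]; ring
  · have hlow : ∀ x ∈ Metric.closedBall (0 : E N) r,
        b / 2 * √(c * ε) ≤ ‖(s • reFourierInv η) x‖ := by
      intro x hx
      rw [mem_closedBall_zero_iff] at hx
      have h1 := half_integral_le_reFourierInv hη0 (r := r) (fun ξ h => by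
        have := norm_le_of_bandFun_ne_zero hε hε1 h
        rw [hr, mul_one_div]
        exact div_le_one_of_le₀ this (Real.sqrt_nonneg _)) hx
      refine le_trans ?_ (Real.le_norm_self _)
      rw [hus]
      calc b / 2 * √(c * ε) ≤ b / 2 * √J := by gcongr
        _ = s * (J / 2) := by
            rw [hs]
            nth_rewrite 3 [← Real.mul_self_sqrt hJpos.le]
            have := (Real.sqrt_pos.2 hJpos).ne'
            field_simp
        _ ≤ s * reFourierInv η x := by gcongr; linarith
    have hintp : Integrable (fun x => ‖(s • reFourierInv η) x‖ ^ p) volume := by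
      have := ((s • reFourierInv η).memLp (ENNReal.ofReal p) volume).integrable_norm_rpow
        (by simpa using hp) ENNReal.ofReal_ne_top
      rwa [ENNReal.toReal_ofReal hp.le] at this
    calc V * ((b / 2) ^ p * c ^ (p / 2)) * ε ^ (p / 2)
        = V * (b / 2 * √(c * ε)) ^ p := by
          rw [Real.mul_rpow (by positivity) (by positivity), Real.sqrt_eq_rpow,
            ← Real.rpow_mul (by positivity), Real.mul_rpow hc.le hε.le, one_div_mul_eq_div]
          ring
      _ = ∫ x in Metric.closedBall (0 : E N) r, (b / 2 * √(c * ε)) ^ p := by simp [hV]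
      _ ≤ ∫ x in Metric.closedBall (0 : E N) r, ‖(s • reFourierInv η) x‖ ^ p := by
          refine setIntegral_mono_on (by simp [measure_closedBall_lt_top]) hintp.integrableOn
            measurableSet_closedBall fun x hx => ?_
          exact Real.rpow_le_rpow (by positivity) (hlow x hx) hp.le
      _ ≤ _ := setIntegral_le_integral hintp (Eventually.of_forall fun x => by positivity)

/-! ### Radial functions of low energy -/

/-- `κ²‖u‖₂² + ‖Δu‖₂² - 2κ‖∇u‖₂²` is the perfect square `‖Δu + κu‖₂²`. -/
theorem H2.lnorm_lap_sq_sub (u : H2 N) (κ : ℝ) :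
    lnorm u.lap 2 ^ 2 - 2 * κ * lnorm u.grad 2 ^ 2
      = (∫ x, (u.lap x + κ * u.toFun x) ^ 2) - κ ^ 2 * lnorm u.toFun 2 ^ 2 := by
  have h1 : ∫ x, (u.lap x + κ * u.toFun x) ^ 2 = ∫ x, (u.lap x ^ 2
      + 2 * κ * (u.toFun x * u.lap x)) + κ ^ 2 * u.toFun x ^ 2 :=
    integral_congr_ae (Eventually.of_forall fun x => by ring)
  have h2 : Integrable (fun x => 2 * κ * (u.toFun x * u.lap x)) volume :=
    (u.memLp_toFun.integrable_mul u.memLp_lap).const_mul _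
  have h3 : Integrable (fun x => u.lap x ^ 2 + 2 * κ * (u.toFun x * u.lap x)) volume :=
    u.memLp_lap.integrable_sq.add h2
  rw [h1, integral_add h3
    (u.memLp_toFun.integrable_sq.const_mul _), integral_add u.memLp_lap.integrable_sq h2,
    integral_const_mul, integral_const_mul, u.lnorm_grad_sq, lnorm_two_sq_real u.memLp_lap,
    lnorm_two_sq_real u.memLp_toFun]
  ring

/-- For `p < 4` the power `ε²` is negligible against `ε^(p/2)` as `ε → 0`. -/
theorem exists_pos_rpow_balance {p κ A B : ℝ} (hp4 : p < 4) (hκ : 0 < κ)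
    (hB : 0 < B) : ∃ ε : ℝ, 0 < ε ∧ ε ≤ 1 ∧ ε < κ ∧ ε ^ 2 * A < B * ε ^ (p / 2) := by
  have h0 : 0 < 2 - p / 2 := by linarith
  have h1 : Tendsto (fun ε : ℝ => ε ^ (2 - p / 2) * A) (𝓝[>] 0) (𝓝 0) := by
    have := ((Real.continuousAt_rpow_const 0 (2 - p / 2) (Or.inr h0.le)).tendsto.mul_const
      A).mono_left (nhdsWithin_le_nhds (s := Set.Ioi (0 : ℝ)))
    rwa [Real.zero_rpow h0.ne', zero_mul] at this
  have h2 : ∀ᶠ ε : ℝ in 𝓝[>] 0, ε ∈ Set.Ioo 0 (min 1 κ) :=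
    Ioo_mem_nhdsGT (lt_min one_pos hκ)
  obtain ⟨ε, h3, h4, h5⟩ := ((h1.eventually (gt_mem_nhds hB)).and h2).exists
  refine ⟨ε, h4, (h5.trans_le (min_le_left _ _)).le, h5.trans_le (min_le_right _ _), ?_⟩
  have h6 : ε ^ 2 = ε ^ (2 - p / 2) * ε ^ (p / 2) := by
    rw [← Real.rpow_add h4, sub_add_cancel, Real.rpow_two]
  calc ε ^ 2 * A = (ε ^ (2 - p / 2) * A) * ε ^ (p / 2) := by rw [h6]; ring
    _ < B * ε ^ (p / 2) := by gcongr

theorem exists_radial_genEnergy_lt (hN : 2 ≤ N) {p κ θ b : ℝ} (hp : 0 < p) (hp4 : p < 4)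
    (hκ : 0 < κ) (hθ : 0 < θ) (hb : 0 < b) :
    ∃ u : H2 N, IsRadial u ∧ u ∈ sphere N b ∧ lnorm u.lap 2 < 2 * κ * b ∧
      genEnergy p κ θ u < -(κ ^ 2 * b ^ 2) := by
  obtain ⟨c, hc, H⟩ := exists_schwartz_concentrating hN hp hκ hb
  obtain ⟨ε, hε, hε1, hεκ, hlt⟩ :=
    exists_pos_rpow_balance (A := b ^ 2) hp4 hκ (mul_pos hθ hc)
  obtain ⟨v, ⟨f, hf⟩, hmass, hlap, hlow⟩ := H ε hε hε1
  set u := H2.ofSchwartz v with hu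
  have hm : lnorm u.toFun 2 ^ 2 = b ^ 2 := by
    rw [lnorm_two_sq_real u.memLp_toFun]; exact hmass
  have hm' : lnorm u.toFun 2 = b := (sq_eq_sq₀ (lnorm_nonneg _ _) hb.le).1 hm
  have hP : lnorm u.toFun p ^ p = ∫ x, ‖v x‖ ^ p := lnorm_rpow (f := v) hp (v.memLp _)
  have hsq := u.lnorm_lap_sq_sub κ
  have hlap' : ∫ x, (u.lap x + κ * u.toFun x) ^ 2 ≤ ε ^ 2 * b ^ 2 := hlap
  rw [hm] at hsq
  refine ⟨u, ⟨f, Eventually.of_forall hf⟩, hm, ?_, ?_⟩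
  -- `(‖Δu‖₂ - κb)² ≤ ‖Δu + κu‖₂² ≤ (εb)²`, and `ε < κ`.
  · have h1 := u.lnorm_grad_sq_le
    rw [hm'] at h1
    have h2 := mul_le_mul_of_nonneg_left h1 (by positivity : 0 ≤ 2 * κ)
    have h3 : (lnorm u.lap 2 - κ * b) ^ 2 ≤ (ε * b) ^ 2 := by nlinarith
    have h4 := (le_abs_self _).trans (abs_le_of_sq_le_sq h3 (by positivity))
    have h5 := mul_lt_mul_of_pos_right hεκ hb
    linarith
  · have h1 := mul_le_mul_of_nonneg_left hlow hθ.le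
    unfold genEnergy
    rw [hP]
    linarith

/-! ### The left end points `R₀` and `R̃₀` -/

/-- The witness `t = B (q - 1) / (q - 2)` maximizes `(t - B) / t^(q - 1)`, and the threshold for `K`
is the value at which the expression vanishes there. -/
theorem exists_pos_of_lt_threshold {q K B : ℝ} (hq : 2 < q) (hB : 0 < B)
    (h : K * B ^ (q - 2) < 1 / (q - 1) * ((q - 2) / (q - 1)) ^ (q - 2)) :
    ∃ t > 0, 0 < t ^ 2 - B * t - K * t ^ q := by
  have h1 : 0 < q - 1 := by linarith
  have h2 : 0 < q - 2 := by linarith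
  set x := (q - 1) / (q - 2) with hx
  have hxpos : 0 < x := by positivity
  refine ⟨B * x, by positivity, ?_⟩
  have hinv : ((q - 2) / (q - 1)) ^ (q - 2) * x ^ (q - 2) = 1 := by
    rw [← Real.mul_rpow (by positivity) hxpos.le, hx, div_mul_div_cancel₀ h1.ne',
      div_self h2.ne', Real.one_rpow]
  have h3 : K * B ^ (q - 2) * x ^ (q - 2) < 1 / (q - 1) := by
    calc _ < 1 / (q - 1) * ((q - 2) / (q - 1)) ^ (q - 2) * x ^ (q - 2) := by gcongr
      _ = 1 / (q - 1) := by rw [mul_assoc, hinv, mul_one]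
  have h4 : (B * x) ^ q = B ^ (q - 2) * x ^ (q - 2) * (B * x) ^ 2 := by
    rw [← Real.mul_rpow hB.le hxpos.le, ← Real.rpow_two, ← Real.rpow_add (by positivity),
      sub_add_cancel]
  have h5 : (B * x) ^ 2 - B * (B * x) = 1 / (q - 1) * (B * x) ^ 2 := by
    rw [hx]; field_simp; ring
  rw [h5, h4]
  have := mul_lt_mul_of_pos_right h3 (by positivity : 0 < (B * x) ^ 2)
  linarith

/-- Positivity of `t² - Bt - Kt^q` at some `t > 0` needs `t > B`. Nonemptiness of the set matters,
as `sInf ∅ = 0`. -/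
theorem le_sInf_of_pos {q K B : ℝ} (hq : 2 < q) (hB : 0 < B) (hK : 0 ≤ K)
    (h : K * B ^ (q - 2) < 1 / (q - 1) * ((q - 2) / (q - 1)) ^ (q - 2)) :
    B ≤ sInf {t : ℝ | 0 < t ∧ 0 < t ^ 2 - B * t - K * t ^ q} := by
  refine le_csInf (exists_pos_of_lt_threshold hq hB h) ?_
  rintro t ⟨ht, h1⟩
  have h2 : 0 ≤ K * t ^ q := by positivity
  by_contra hlt
  push Not at hlt
  nlinarith

theorem le_R0 {p C a μ : ℝ} (hp : 0 < p) (hq : 2 < p * gam N p) (hC : 0 < C) (ha : 0 < a)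
    (hμ : 0 < μ) (h : μ ^ (p * gam N p - 2) * a ^ (p - 2) < Ctilde N p C) :
    μ * a ≤ R0 N p C a μ := by
  unfold Ctilde at h
  set q := p * gam N p with hqdef
  have hCp : 0 < C ^ p := Real.rpow_pos_of_pos hC p
  have hset : {t : ℝ | 0 < t ∧ 0 < hfun N p C a μ t}
      = {t : ℝ | 0 < t ∧ 0 < t ^ 2 - μ * a * t - 2 * C ^ p / p * a ^ (p - q) * t ^ q} := by
    ext t
    have : hfun N p C a μ t
        = 1 / 2 * (t ^ 2 - μ * a * t - 2 * C ^ p / p * a ^ (p - q) * t ^ q) := by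
      rw [hfun, mul_sub, mul_one, ← hqdef]; ring
    simp [this]
  rw [R0, hset]
  refine le_sInf_of_pos hq (by positivity) (by positivity) ?_
  have h1 : a ^ (p - q) * (μ * a) ^ (q - 2) = μ ^ (q - 2) * a ^ (p - 2) := by
    rw [Real.mul_rpow hμ.le ha.le, mul_left_comm, ← Real.rpow_add ha]
    congr 2; ring
  rw [mul_assoc, h1]
  have h2 : 0 < q - 1 := by linarith
  calc _ < 2 * C ^ p / p * (p / (2 * (q - 1) * C ^ p) * ((q - 2) / (q - 1)) ^ (q - 2)) := by
        gcongr
    _ = _ := by field_simp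

theorem le_R0til {p C a μ : ℝ} (hp : 2 < p) (hq : 2 < p * gam N p) (hC : 0 < C) (ha : 0 < a)
    (hμ : 0 < μ) (h : μ ^ (p * gam N p - 2) * a ^ (p - 2) < Ctilde N p C) :
    2 * (a * √(ctil N p μ)) ≤ R0til N p C a μ := by
  unfold Ctilde at h
  have hqN : p * gam N p = N / 2 * ((p - 2) / 2) := by
    rw [gam]; field_simp; ring
  set q := p * gam N p with hqdef
  have hCp : 0 < C ^ p := Real.rpow_pos_of_pos hC p
  have hc : 0 < ctil N p μ := by unfold ctil; positivity
  set b := a * √(ctil N p μ) with hb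
  have hbpos : 0 < b := by positivity
  have hset : {t : ℝ | 0 < t ∧ 0 < htil N p C a μ t}
      = {t : ℝ | 0 < t ∧ 0 < t ^ 2 - 2 * b * t - C ^ p / p * b ^ (p - q) * t ^ q} := by
    ext t
    have : htil N p C a μ t = t ^ 2 - 2 * b * t - C ^ p / p * b ^ (p - q) * t ^ q := by
      rw [htil, mul_sub, mul_one, ← hqdef]
    simp [this]
  rw [R0til, hset]
  refine le_sInf_of_pos hq (by positivity) (by positivity) ?_
  have h1 : b ^ (p - q) * (2 * b) ^ (q - 2) = 2 ^ (q - 2) * b ^ (p - 2) := by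
    rw [Real.mul_rpow two_pos.le hbpos.le, mul_left_comm, ← Real.rpow_add hbpos]
    congr 2; ring
  -- The scaling constant is chosen so that both smallness conditions become the same.
  have h3 : √(ctil N p μ) ^ (p - 2) = 8 / μ ^ 2 * (μ / 2) ^ q := by
    have h8 : (0 : ℝ) < 8 / μ ^ 2 := by positivity
    have hp2 : p - 2 ≠ 0 := by linarith
    rw [Real.sqrt_eq_rpow, ← Real.rpow_mul hc.le, ctil,
      Real.mul_rpow (by positivity) (by positivity), ← Real.rpow_mul h8.le,
      ← Real.rpow_mul (by positivity : 0 ≤ μ / 2), hqN]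
    congr 1
    · rw [show 2 / (p - 2) * (1 / 2 * (p - 2)) = 1 by field_simp, Real.rpow_one]
    · congr 1; ring
  have h4 : (2 : ℝ) ^ (q - 2) * b ^ (p - 2) = 2 * (μ ^ (q - 2) * a ^ (p - 2)) := by
    rw [hb, Real.mul_rpow ha.le (Real.sqrt_nonneg _), h3, Real.div_rpow hμ.le two_pos.le,
      Real.rpow_sub two_pos, Real.rpow_sub hμ, Real.rpow_two, Real.rpow_two]
    have := (Real.rpow_pos_of_pos two_pos q).ne'
    field_simp
    norm_num
  rw [mul_assoc, h1, h4]
  have h2 : 0 < q - 1 := by linarith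
  calc _ < C ^ p / p * (2 * (p / (2 * (q - 1) * C ^ p) * ((q - 2) / (q - 1)) ^ (q - 2))) := by
        gcongr
    _ = _ := by field_simp

/-! ### The three levels -/

theorem energy_eq {N : ℕ} (p μ : ℝ) (u : H2 N) :
    energy p μ u = 1 / 2 * genEnergy p (μ / 2) (2 / p) u := by
  rw [energy, genEnergy]; ring

theorem Phi0_eq {N : ℕ} (p : ℝ) (v : H2 N) : Phi0 p v = genEnergy p 1 (1 / p) v := by
  rw [Phi0, genEnergy]; ring

theorem levels_lt {N : ℕ} (hN : 5 ≤ N) {p : ℝ} (hp : 2 + 8 / (N : ℝ) < p) (hp4 : p < 4)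
    (hpcrit : p < 2 * (N : ℝ) / ((N : ℝ) - 4)) {C : ℝ} (hCpos : 0 < C)
    (hC : bestGN N p ≤ ENNReal.ofReal C) {a μ : ℝ} (ha : 0 < a) (hμ : 0 < μ)
    (hsmall : μ ^ (p * gam N p - 2) * a ^ (p - 2) < Ctilde N p C) :
    mPhi0 N p C a μ < -(ctil N p μ * a ^ 2) ∧ mLevel N p C a μ < -(a ^ 2 * μ ^ 2 / 8) ∧
      mLevelRad N p C a μ < -(a ^ 2 * μ ^ 2 / 8) := by
  have hN5 : (5 : ℝ) ≤ N := by exact_mod_cast hN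
  have hN2 : 2 ≤ N := by omega
  have hp2 : 2 < p := lt_trans (by linarith [show 0 < 8 / (N : ℝ) by positivity]) hp
  have hp0 : 0 < p := by linarith
  have hγ0 : 0 ≤ gam N p := by
    have : 0 ≤ p - 2 := by linarith
    unfold gam; positivity
  have hγ1 : gam N p ≤ 1 := by
    rw [lt_div_iff₀ (by linarith)] at hpcrit
    rw [gam, div_le_one (by positivity)]
    linarith
  have hq : 2 < p * gam N p := by
    have h1 : 8 / (N : ℝ) < p - 2 := by linarith
    rw [div_lt_iff₀ (by linarith)] at h1
    have h2 : p * gam N p = N * (p - 2) / 4 := by rw [gam]; field_simp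
    rw [h2]; linarith
  have hc : 0 < ctil N p μ := by unfold ctil; positivity
  have hbdd : BddBelow (energy p μ '' ballA N a (R0 N p C a μ)) := by
    obtain ⟨m, hm⟩ := bddBelow_genEnergy hp0.le hγ0 hγ1 hCpos hC (κ := μ / 2) (θ := 2 / p)
      (by positivity) (by positivity) ha.le (R0 N p C a μ)
    refine ⟨1 / 2 * m, ?_⟩
    rintro _ ⟨u, hu, rfl⟩
    have := hm ⟨u, hu, rfl⟩
    rw [energy_eq]
    linarith
  obtain ⟨u, hrad, hmass, hlap, hE⟩ := exists_radial_genEnergy_lt hN2 hp0 hp4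
    (half_pos hμ) (div_pos two_pos hp0) ha
  have hmem : u ∈ ballA N a (R0 N p C a μ) :=
    ⟨hmass, hlap.trans_le (by linarith [le_R0 hp0 hq hCpos ha hμ hsmall])⟩
  have hEu : energy p μ u < -(a ^ 2 * μ ^ 2 / 8) := by
    rw [energy_eq]; linarith
  refine ⟨?_, ?_, ?_⟩
  · obtain ⟨v, -, hvmass, hvlap, hv⟩ := exists_radial_genEnergy_lt hN2 hp0 hp4
      one_pos (div_pos one_pos hp0) (mul_pos ha (Real.sqrt_pos.2 hc))
    have hmemv : v ∈ ballA N (a * √(ctil N p μ)) (R0til N p C a μ) :=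
      ⟨hvmass, hvlap.trans_le (by linarith [le_R0til hp2 hq hCpos ha hμ hsmall])⟩
    have hbddv := bddBelow_genEnergy hp0.le hγ0 hγ1 hCpos hC (κ := 1) (θ := 1 / p) zero_le_one
      (by positivity) (mul_pos ha (Real.sqrt_pos.2 hc)).le (R0til N p C a μ)
    rw [mPhi0, funext (Phi0_eq (N := N) p)]
    refine (csInf_le hbddv ⟨v, hmemv, rfl⟩).trans_lt (hv.trans_eq ?_)
    rw [mul_pow, Real.sq_sqrt hc.le]; ring
  · exact (csInf_le hbdd ⟨u, hmem, rfl⟩).trans_lt hEu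
  · refine (csInf_le (s := energy p μ '' ballArad N a (R0 N p C a μ))
      (hbdd.mono (Set.image_mono fun w hw => hw.1))
      ⟨u, ⟨hmem, hrad⟩, rfl⟩).trans_lt hEu

end BiharmonicNLS

end

theorem lemma3p4 (N : ℕ) (hN : 5 ≤ N) (p : ℝ)
    (hp : 2 + 8 / (N : ℝ) < p) (hp4 : p < 4) (hpcrit : p < 2 * (N : ℝ) / ((N : ℝ) - 4))
    -- `C` is any admissible constant in the Gagliardo–Nirenberg inequality
    (C : ℝ) (hCpos : 0 < C) (hC : BiharmonicNLS.bestGN N p ≤ ENNReal.ofReal C)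
    (a μ : ℝ) (ha : 0 < a) (hμ : 0 < μ)
    (hsmall : μ ^ (p * BiharmonicNLS.gam N p - 2) * a ^ (p - 2) < BiharmonicNLS.Ctilde N p C) :
    BiharmonicNLS.mPhi0 N p C a μ < -(BiharmonicNLS.ctil N p μ * a ^ 2) ∧
    BiharmonicNLS.mLevel N p C a μ < -(a ^ 2 * μ ^ 2 / 8) ∧
    BiharmonicNLS.mLevelRad N p C a μ < -(a ^ 2 * μ ^ 2 / 8) :=
  BiharmonicNLS.levels_lt hN hp hp4 hpcrit hCpos hC ha hμ hsmall
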